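/- **Proposition 2.4.** Let $1\le p\le\infty$ and let $p^*$ be its conjugate exponent, $\frac1p+\frac1{p^*}=1$. Let $X$ and $Y$ be pointed metric spaces, with base points denoted by $0$, and let $T:X\to Y$ be a Lipschitz map with $T(0)=0$. *Notation.* All vector spaces are real. $X^{\#}$ is the space of Lipschitz functions $f:X\to\mathbb R$ with $f(0)=0$, normed by $\mathrm{Lip}(f)=\sup_{x\ne y}|f(x)-f(y)|/d(x,y)$ (equal to $0$ if $X$ is a single point). For $x,y\in X$ let $\delta_{(x,y)}\in (X^{\#})^*$ be $\delta_{(x,y)}(f)=f(x)-f(y)$; the Lipschitz-free space $\mathcal F(X)$ is the closed linear span of these forms in $(X^{\#})^*$. Let $T^{\#}:Y^{\#}\to X^{\#}$ be $T^{\#}(g)=g\circ T$, and let $\widetilde T:\mathcal F(X)\to\mathcal F(Y)$ be the bounded linear operator with $\widetilde T(\delta_{(x,y)})=\delta_{(Tx,Ty)}$. For a normed space $E$ and $e_1,\dots,e_n\in E$ put $\|(e_i)\|_{\ell_p^n(E)}=(\sum_i\|e_i\|^p)^{1/p}$ and $\|(e_i)\|_{\ell_p^{n,w}(E)}=\sup_{\|e^*\|_{E^*}\le1}(\sum_i|e^*(e_i)|^p)^{1/p}$,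 with maxima in place of sums if $p=\infty$. For $x,y\in X$ and $e\in E$ let $\delta_{(x,y)}\boxtimes e$ be the linear functional $f\mapsto\langle f(x)-f(y),e\rangle$ on the space of Lipschitz maps $f:X\to E^*$ with $f(0)=0$; the span of these functionals is $X\boxtimes E$. For $u=\sum_{k=1}^l\delta_{(x_k,y_k)}\boxtimes s_k\in X\boxtimes E$ put $$d_p^L(u)=\inf\Big\{\|(m_i)\|_{\ell_p^{n,w}(\mathcal F(X))}\,\|(e_i)\|_{\ell_{p^*}^n(E)}\Big\},$$ the infimum over all $n$, $m_i\in\mathcal F(X)$, $e_i\in E$ with $\sum_{i=1}^n m_i\otimes e_i=\sum_{k=1}^l\delta_{(x_k,y_k)}\otimes s_k$ in the algebraic tensor product $\mathcal F(X)\otimes E$ (this depends only on $u$). *Statement.* The following are equivalent. 1. $T$ is M-strictly Lipschitz $p$-summing: there is $C>0$ such that for all $l$, all $x_k,y_k\in X$ and all $g_k\in Y^{\#}$ ($1\le k\le l$), $$\Big|\sum_{k=1}^l \big(g_k(Tx_k)-g_k(Ty_k)\big)\Big|\le C\,d_p^L\Big(\sum_{k=1}^l\delta_{(x_k,y_k)}\boxtimes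 g_k\Big),$$ where the tensor is taken in $X\boxtimes Y^{\#}$. 2. $\widetilde T:\mathcal F(X)\to\mathcal F(Y)$ is $p$-summing: there is $C>0$ such that $\|(\widetilde T m_i)\|_{\ell_p^n(\mathcal F(Y))}\le C\,\|(m_i)\|_{\ell_p^{n,w}(\mathcal F(X))}$ for all $n$ and all $m_1,\dots,m_n\in\mathcal F(X)$. 3. $T^{\#}:Y^{\#}\to X^{\#}$ is Cohen strongly $p^*$-summing: there is $C>0$ such that $\sum_{i=1}^n|\langle T^{\#}g_i,\varphi_i\rangle|\le C\,\|(g_i)\|_{\ell_{p^*}^n(Y^{\#})}\,\|(\varphi_i)\|_{\ell_p^{n,w}((X^{\#})^*)}$ for all $n$, all $g_1,\dots,g_n\in Y^{\#}$ and all $\varphi_1,\dots,\varphi_n\in(X^{\#})^*$. -/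

import Mathlib

open scoped NNReal ENNReal TensorProduct

noncomputable section

namespace LipschitzSumming

/-! ### Lipschitz functions vanishing at the base point -/

/-- The vector space of all Lipschitz maps `f : X → E` with `f x₀ = 0`. -/
def lipZeroSubmodule {X : Type*} [MetricSpace X] (x₀ : X) (E : Type*) [NormedAddCommGroup E]
    [NormedSpace ℝ E] : Submodule ℝ (X → E) where
  carrier := {f | f x₀ = 0 ∧ ∃ K : ℝ≥0, LipschitzWith K f}
  zero_mem' := ⟨rfl, 0, LipschitzWith.const 0⟩
  add_mem' := by
    rintro f g ⟨hf, K, hK⟩ ⟨hg, L, hL⟩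
    exact ⟨by simp [hf, hg], K + L, hK.add hL⟩
  smul_mem' := by
    rintro c f ⟨hf, K, hK⟩
    exact ⟨by simp [hf], ‖c‖₊ * K, (lipschitzWith_smul c).comp hK⟩

/-- The space `Lip₀(X; E)` of Lipschitz maps `f : X → E` with `f x₀ = 0`, where `X` is a metric
space with base point `x₀`. It is made a normed space below, with the Lipschitz norm. -/
def LipZero {X : Type*} [MetricSpace X] (x₀ : X) (E : Type*) [NormedAddCommGroup E]
    [NormedSpace ℝ E] : Type _ :=
  ↥(lipZeroSubmodule x₀ E)

namespace LipZero

variable {X : Type*} [MetricSpace X] {x₀ : X} {E : Type*} [NormedAddCommGroup E] [NormedSpace ℝ E]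

instance : AddCommGroup (LipZero x₀ E) := inferInstanceAs (AddCommGroup ↥(lipZeroSubmodule x₀ E))

instance : Module ℝ (LipZero x₀ E) := inferInstanceAs (Module ℝ ↥(lipZeroSubmodule x₀ E))

instance : FunLike (LipZero x₀ E) X E where
  coe f := f.1
  coe_injective _ _ h := Subtype.ext h

/-- A Lipschitz map vanishing at the base point, as an element of `Lip₀(X; E)`. -/
def mk (f : X → E) (h₀ : f x₀ = 0) (hf : ∃ K : ℝ≥0, LipschitzWith K f) : LipZero x₀ E :=
  ⟨f, h₀, hf⟩

@[simp] theorem mk_apply (f : X → E) (h₀ : f x₀ = 0) (hf : ∃ K : ℝ≥0, LipschitzWith K f) (x : X) :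
    (mk f h₀ hf : LipZero x₀ E) x = f x := rfl

@[ext] theorem ext {f g : LipZero x₀ E} (h : ∀ x, f x = g x) : f = g := DFunLike.ext f g h

@[simp] theorem zero_apply (x : X) : (0 : LipZero x₀ E) x = 0 := rfl

@[simp] theorem add_apply (f g : LipZero x₀ E) (x : X) : (f + g) x = f x + g x := rfl

@[simp] theorem smul_apply (c : ℝ) (f : LipZero x₀ E) (x : X) : (c • f) x = c • f x := rfl

@[simp] theorem apply_base (f : LipZero x₀ E) : f x₀ = 0 := f.2.1

theorem exists_lipschitzWith (f : LipZero x₀ E) : ∃ K : ℝ≥0, LipschitzWith K f := f.2.2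

/-- The Lipschitz norm `Lip(f) = sup {‖f x - f y‖ / d(x, y) : x ≠ y}`. -/
instance : Norm (LipZero x₀ E) where
  norm f := sSup {r : ℝ | ∃ x y : X, x ≠ y ∧ r = ‖f x - f y‖ / dist x y}

theorem norm_def (f : LipZero x₀ E) :
    ‖f‖ = sSup {r : ℝ | ∃ x y : X, x ≠ y ∧ r = ‖f x - f y‖ / dist x y} := rfl

theorem norm_sub_le (f : LipZero x₀ E) (x y : X) : ‖f x - f y‖ ≤ ‖f‖ * dist x y := by
  rcases eq_or_ne x y with rfl | hxy
  · simp
  obtain ⟨K, hK⟩ := f.exists_lipschitzWith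
  rw [← div_le_iff₀ (dist_pos.2 hxy)]
  refine le_csSup ⟨(K : ℝ), ?_⟩ ⟨x, y, hxy, rfl⟩
  rintro r ⟨a, b, hab, rfl⟩
  rw [div_le_iff₀ (dist_pos.2 hab), ← dist_eq_norm]
  exact hK.dist_le_mul a b

theorem norm_le_of_bound (f : LipZero x₀ E) {C : ℝ} (hC : 0 ≤ C)
    (h : ∀ x y, ‖f x - f y‖ ≤ C * dist x y) : ‖f‖ ≤ C := by
  refine Real.sSup_le ?_ hC
  rintro r ⟨x, y, hxy, rfl⟩
  rw [div_le_iff₀ (dist_pos.2 hxy)]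
  exact h x y

theorem lip_norm_nonneg (f : LipZero x₀ E) : 0 ≤ ‖f‖ := by
  refine Real.sSup_nonneg ?_
  rintro r ⟨x, y, -, rfl⟩
  positivity

theorem lip_norm_smul_le (c : ℝ) (f : LipZero x₀ E) : ‖c • f‖ ≤ ‖c‖ * ‖f‖ := by
  refine norm_le_of_bound _ (mul_nonneg (norm_nonneg c) f.lip_norm_nonneg) fun x y => ?_
  rw [smul_apply, smul_apply, ← smul_sub, norm_smul, mul_assoc]
  exact mul_le_mul_of_nonneg_left (f.norm_sub_le x y) (norm_nonneg c)

theorem normedSpaceCore : NormedSpace.Core ℝ (LipZero x₀ E) where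
  norm_nonneg := lip_norm_nonneg
  norm_smul c f := by
    refine le_antisymm (lip_norm_smul_le c f) ?_
    rcases eq_or_ne c 0 with rfl | hc
    · simpa using lip_norm_nonneg ((0 : ℝ) • f)
    · have h := lip_norm_smul_le c⁻¹ (c • f)
      rw [smul_smul, inv_mul_cancel₀ hc, one_smul, norm_inv] at h
      rwa [← le_inv_mul_iff₀ (norm_pos_iff.2 hc)]
  norm_triangle f g := by
    refine norm_le_of_bound _ (add_nonneg f.lip_norm_nonneg g.lip_norm_nonneg) fun x y => ?_
    rw [add_apply, add_apply, add_sub_add_comm, add_mul]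
    exact (norm_add_le _ _).trans (add_le_add (f.norm_sub_le x y) (g.norm_sub_le x y))
  norm_eq_zero_iff f := by
    constructor
    · intro h
      ext x
      have := f.norm_sub_le x x₀
      rw [h, zero_mul, apply_base, sub_zero] at this
      simpa using this
    · rintro rfl
      refine le_antisymm (norm_le_of_bound _ le_rfl fun x y => ?_) (lip_norm_nonneg _)
      simp

instance : NormedAddCommGroup (LipZero x₀ E) := NormedAddCommGroup.ofCore normedSpaceCore

instance : NormedSpace ℝ (LipZero x₀ E) := NormedSpace.ofCore normedSpaceCore

end LipZero

/-- The Lipschitz dual `X^#` of the pointed metric space `(X, x₀)`. -/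
abbrev LipDual {X : Type*} [MetricSpace X] (x₀ : X) : Type _ := LipZero x₀ ℝ

/-! ### The Lipschitz-free space -/

/-- The linear form `δ_(x,y)` on `X^#`, `δ_(x,y)(f) = f x - f y`. -/
def delta {X : Type*} [MetricSpace X] (x₀ x y : X) : StrongDual ℝ (LipDual x₀) :=
  LinearMap.mkContinuous
    { toFun := fun f => f x - f y
      map_add' := fun f g => add_sub_add_comm (f x) (g x) (f y) (g y)
      map_smul' := fun c f => (mul_sub c (f x) (f y)).symm }
    (dist x y) fun f => (f.norm_sub_le x y).trans_eq (mul_comm _ _)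

@[simp] theorem delta_apply {X : Type*} [MetricSpace X] (x₀ x y : X) (f : LipDual x₀) :
    delta x₀ x y f = f x - f y := rfl

/-- The Lipschitz-free space `F(X)`: the closed linear span of the `δ_(x,y)` in the dual
of `X^#`, with the norm of that dual. -/
def lipFree {X : Type*} [MetricSpace X] (x₀ : X) : Submodule ℝ (StrongDual ℝ (LipDual x₀)) :=
  (Submodule.span ℝ (Set.range fun q : X × X => delta x₀ q.1 q.2)).topologicalClosure

/-- `δ_(x,y)` as an element of `F(X)`. -/
def freeDelta {X : Type*} [MetricSpace X] (x₀ x y : X) : ↥(lipFree x₀) :=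
  ⟨delta x₀ x y, Submodule.le_topologicalClosure _ (Submodule.subset_span ⟨(x, y), rfl⟩)⟩

/-! ### The Lipschitz adjoint and the linearization -/

/-- The Lipschitz adjoint `T^# : Y^# → X^#`, `T^#(g) = g ∘ T`, of a base point preserving
Lipschitz map `T : X → Y`. -/
def lipAdjoint {X Y : Type*} [MetricSpace X] [MetricSpace Y] {x₀ : X} {y₀ : Y} (T : X → Y)
    {K : ℝ≥0} (hT : LipschitzWith K T) (hT₀ : T x₀ = y₀) : LipDual y₀ →L[ℝ] LipDual x₀ :=
  LinearMap.mkContinuous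
    { toFun := fun g => LipZero.mk (fun x => g (T x)) (by simp [hT₀])
        (let ⟨L, hL⟩ := g.exists_lipschitzWith; ⟨L * K, hL.comp hT⟩)
      map_add' := fun f g => rfl
      map_smul' := fun c f => rfl }
    K fun g => by
      refine LipZero.norm_le_of_bound _ (mul_nonneg K.2 (norm_nonneg g)) fun x y => ?_
      refine (g.norm_sub_le (T x) (T y)).trans ?_
      rw [mul_comm (K : ℝ), mul_assoc]
      exact mul_le_mul_of_nonneg_left (hT.dist_le_mul x y) (norm_nonneg g)

@[simp] theorem lipAdjoint_apply {X Y : Type*} [MetricSpace X] [MetricSpace Y] {x₀ : X} {y₀ : Y}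
    (T : X → Y) {K : ℝ≥0} (hT : LipschitzWith K T) (hT₀ : T x₀ = y₀) (g : LipDual y₀) (x : X) :
    lipAdjoint T hT hT₀ g x = g (T x) := rfl

/-- The transpose of `T^#`, a bounded operator from the dual of `X^#` to the dual of `Y^#`. -/
def lipAdjointTranspose {X Y : Type*} [MetricSpace X] [MetricSpace Y] {x₀ : X} {y₀ : Y}
    (T : X → Y) {K : ℝ≥0} (hT : LipschitzWith K T) (hT₀ : T x₀ = y₀) :
    StrongDual ℝ (LipDual x₀) →L[ℝ] StrongDual ℝ (LipDual y₀) :=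
  (lipAdjoint T hT hT₀).precomp ℝ

theorem lipAdjointTranspose_mem {X Y : Type*} [MetricSpace X] [MetricSpace Y] {x₀ : X} {y₀ : Y}
    (T : X → Y) {K : ℝ≥0} (hT : LipschitzWith K T) (hT₀ : T x₀ = y₀) (m : ↥(lipFree x₀)) :
    lipAdjointTranspose T hT hT₀ m ∈ lipFree y₀ := by
  refine map_mem_closure (lipAdjointTranspose T hT hT₀).continuous m.2 fun v hv => ?_
  refine Submodule.span_induction (p := fun v _ => lipAdjointTranspose T hT hT₀ v ∈
    Submodule.span ℝ (Set.range fun q : Y × Y => delta y₀ q.1 q.2)) ?_ ?_ ?_ ?_ hv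
  · rintro _ ⟨⟨x, y⟩, rfl⟩
    exact Submodule.subset_span ⟨(T x, T y), rfl⟩
  · simp
  · intro a b _ _ ha hb
    rw [map_add]
    exact add_mem ha hb
  · intro c a _ ha
    rw [map_smul]
    exact Submodule.smul_mem _ c ha

/-- The linearization `T̃ : F(X) → F(Y)` of a base point preserving Lipschitz map `T : X → Y`:
the bounded linear operator with `T̃(δ_(x,y)) = δ_(Tx,Ty)`. It is the restriction to `F(X)` of
the transpose of `T^#`. -/
def linearization {X Y : Type*} [MetricSpace X] [MetricSpace Y] {x₀ : X} {y₀ : Y} (T : X → Y)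
    {K : ℝ≥0} (hT : LipschitzWith K T) (hT₀ : T x₀ = y₀) : ↥(lipFree x₀) →L[ℝ] ↥(lipFree y₀) :=
  ((lipAdjointTranspose T hT hT₀).comp (lipFree x₀).subtypeL).codRestrict (lipFree y₀)
    (lipAdjointTranspose_mem T hT hT₀)

theorem linearization_freeDelta {X Y : Type*} [MetricSpace X] [MetricSpace Y] {x₀ : X} {y₀ : Y}
    (T : X → Y) {K : ℝ≥0} (hT : LipschitzWith K T) (hT₀ : T x₀ = y₀) (x y : X) :
    linearization T hT hT₀ (freeDelta x₀ x y) = freeDelta y₀ (T x) (T y) := rfl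

/-! ### Strong and weak `ℓ_p` norms, summing linear operators -/

/-- The norm of `(e_i)` in `ℓ_p^n(E)`: `(∑ ‖e_i‖ ^ p) ^ (1 / p)`, and `max ‖e_i‖` if `p = ∞`. -/
def strongNorm (p : ℝ≥0∞) {E : Type*} [NormedAddCommGroup E] {n : ℕ} (e : Fin n → E) : ℝ :=
  ‖(WithLp.toLp p e : PiLp p fun _ : Fin n => E)‖

/-- The norm of `(e_i)` in `ℓ_p^{n,w}(E)`: the supremum of `‖(φ(e_i))‖_{ℓ_p^n}` over the closed
unit ball of the dual of `E`. -/
def weakNorm (p : ℝ≥0∞) {E : Type*} [NormedAddCommGroup E] [NormedSpace ℝ E] {n : ℕ}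
    (e : Fin n → E) : ℝ :=
  sSup {r : ℝ | ∃ φ : StrongDual ℝ E, ‖φ‖ ≤ 1 ∧ r = strongNorm p fun i => φ (e i)}

/-- `p`-summing linear operators. -/
def IsSumming (p : ℝ≥0∞) {E F : Type*} [NormedAddCommGroup E] [NormedSpace ℝ E]
    [NormedAddCommGroup F] [NormedSpace ℝ F] (R : E →L[ℝ] F) : Prop :=
  ∃ C : ℝ, 0 < C ∧ ∀ (n : ℕ) (x : Fin n → E),
    strongNorm p (fun i => R (x i)) ≤ C * weakNorm p x

/-- Cohen strongly `p`-summing linear operators. -/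
def IsCohenStronglySumming (p : ℝ≥0∞) {E F : Type*} [NormedAddCommGroup E] [NormedSpace ℝ E]
    [NormedAddCommGroup F] [NormedSpace ℝ F] (R : E →L[ℝ] F) : Prop :=
  ∃ C : ℝ, 0 < C ∧ ∀ (n : ℕ) (x : Fin n → E) (φ : Fin n → StrongDual ℝ F),
    ∑ i, |φ i (R (x i))| ≤ C * strongNorm p x * weakNorm p.conjExponent φ

/-! ### The Lipschitz tensor product and M-strictly Lipschitz summing maps -/

/-- The linear functional `δ_(x,y) ⊠ e` on `Lip₀(X; E*)`, `f ↦ ⟨f x - f y, e⟩`. -/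
def boxFunctional {X : Type*} [MetricSpace X] (x₀ x y : X) {E : Type*} [NormedAddCommGroup E]
    [NormedSpace ℝ E] (e : E) : Module.Dual ℝ (LipZero x₀ (StrongDual ℝ E)) where
  toFun f := (f x - f y) e
  map_add' f g := add_sub_add_comm (f x e) (g x e) (f y e) (g y e)
  map_smul' c f := (mul_sub c (f x e) (f y e)).symm

/-- The Lipschitz tensor product `X ⊠ E`. -/
def lipTensor {X : Type*} [MetricSpace X] (x₀ : X) (E : Type*) [NormedAddCommGroup E]
    [NormedSpace ℝ E] : Submodule ℝ (Module.Dual ℝ (LipZero x₀ (StrongDual ℝ E))) :=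
  Submodule.span ℝ
    {ψ | ∃ (x y : X) (e : E), ψ = boxFunctional x₀ x y e}

/-- `δ_(x,y) ⊠ e` as an element of `X ⊠ E`. -/
def box {X : Type*} [MetricSpace X] (x₀ x y : X) {E : Type*} [NormedAddCommGroup E]
    [NormedSpace ℝ E] (e : E) : ↥(lipTensor x₀ E) :=
  ⟨boxFunctional x₀ x y e, Submodule.subset_span ⟨x, y, e, rfl⟩⟩

/-- The set `A_u` of tensors in `F(X) ⊗ E` that correspond to `u ∈ X ⊠ E`: those of the form
`∑ δ_(x_k,y_k) ⊗ s_k` with `u = ∑ δ_(x_k,y_k) ⊠ s_k`. -/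
def tensorsOf {X : Type*} [MetricSpace X] {x₀ : X} {E : Type*} [NormedAddCommGroup E]
    [NormedSpace ℝ E] (u : ↥(lipTensor x₀ E)) : Set (↥(lipFree x₀) ⊗[ℝ] E) :=
  {m | ∃ (l : ℕ) (x y : Fin l → X) (s : Fin l → E),
    u = ∑ k, box x₀ (x k) (y k) (s k) ∧ m = ∑ k, freeDelta x₀ (x k) (y k) ⊗ₜ[ℝ] s k}

/-- The Lipschitz cross-norm `d_p^L` on `X ⊠ E`: the infimum of
`‖(m_i)‖_{ℓ_p^{n,w}(F(X))} * ‖(e_i)‖_{ℓ_{p*}^n(E)}` over all representations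
`∑ m_i ⊗ e_i`, with `m_i ∈ F(X)` and `e_i ∈ E`, of tensors in `A_u`. -/
def lipCrossNorm (p : ℝ≥0∞) {X : Type*} [MetricSpace X] {x₀ : X} {E : Type*}
    [NormedAddCommGroup E] [NormedSpace ℝ E] (u : ↥(lipTensor x₀ E)) : ℝ :=
  sInf {r : ℝ | ∃ (n : ℕ) (m : Fin n → ↥(lipFree x₀)) (e : Fin n → E),
    ∑ i, m i ⊗ₜ[ℝ] e i ∈ tensorsOf u ∧ r = weakNorm p m * strongNorm p.conjExponent e}

/-- M-strictly Lipschitz `p`-summing maps between the pointed metric spaces `(X, x₀)`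
and `(Y, y₀)`. -/
def IsMStrictlyLipschitzSumming (p : ℝ≥0∞) {X Y : Type*} [MetricSpace X] [MetricSpace Y]
    (x₀ : X) (y₀ : Y) (T : X → Y) : Prop :=
  ∃ C : ℝ, 0 < C ∧ ∀ (l : ℕ) (x y : Fin l → X) (g : Fin l → LipDual y₀),
    |∑ k, (g k (T (x k)) - g k (T (y k)))| ≤
      C * lipCrossNorm p (∑ k, box x₀ (x k) (y k) (g k))

end LipschitzSumming

end

/-!
All three properties are restatements of one estimate, `LipschitzSumming.IsPairingBounded`:
`|∑ ⟨m_i, T^# g_i⟩| ≤ C ‖(m_i)‖_{p,w} ‖(g_i)‖_{p*}` for finite families `m_i ∈ F(X)`, `g_i ∈ Y^#`.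

* Since `⟨m, T^# g⟩ = ⟨T̃ m, g⟩`, Hölder's inequality derives the estimate from the `p`-summability
  of `T̃`. Conversely, the `ℓ_p` norm of `(‖T̃ m_i‖)` is a sum `∑ a_i ‖T̃ m_i‖` with `(a_i)` in the
  unit ball of `ℓ_{p*}`, and some `g_i` in the unit ball of `Y^#` recovers half of `‖T̃ m_i‖`.
* The number `∑ (g_k(T x_k) - g_k(T y_k))` is the value of `u = ∑ δ_(x_k,y_k) ⊠ g_k` at the
  Lipschitz map `x ↦ δ_(Tx,y₀)`, hence equals the pairing `∑ ⟨m_i, T^# e_i⟩` for every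
  representation `∑ m_i ⊗ e_i` that enters `d_p^L(u)` (`tensorPairing_eq_of_mem`). Thus the M-strict
  inequality is the estimate for the `m_i` in the span of the forms `δ_(x,y)`; these are dense in
  `F(X)`, and both sides of the estimate are continuous in `(m_i)`.
* As `F(X)` lies in `(X^#)*`, the Cohen inequality contains the estimate. The converse has to pass
  from `F(X)` to its bidual and is the only step that needs more than unwinding. If
  `m ↦ ∑ ℓ_i(m_i)` is bounded by `C` times the weak norm, a finite set of functionals `ψ` that
  norms `ℓ_p^n` up to a factor `2` and the Hahn–Banach theorem give an exact decomposition
  `ℓ_i = ∑_ψ ψ(single i) h_ψ` with `∑ ‖h_ψ‖ ≤ 4 C` (`exists_dual_decomposition`). As the sum is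
  finite, any family `φ_i` of bounded functionals can be applied to it (`sum_apply_dual_le`). Only
  the map `F(X)* → X^#`, `h ↦ (x ↦ h(δ_(x,x₀)))`, of norm at most `1`, is needed to identify the
  two spaces.
-/

namespace LipschitzSumming

/-! ### Strong and weak `ℓ_p` norms -/

section Norms

variable {E F : Type*} [NormedAddCommGroup E] [NormedAddCommGroup F] {n : ℕ}

theorem strongNorm_one (e : Fin n → E) : strongNorm 1 e = ∑ i, ‖e i‖ :=
  PiLp.norm_eq_of_L1 _

theorem strongNorm_top (e : Fin n → E) : strongNorm ∞ e = ⨆ i, ‖e i‖ := rfl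

theorem strongNorm_eq_sum {p : ℝ≥0∞} (hp : 0 < p.toReal) (e : Fin n → E) :
    strongNorm p e = (∑ i, ‖e i‖ ^ p.toReal) ^ (1 / p.toReal) :=
  PiLp.norm_eq_sum hp _

theorem strongNorm_nonneg (p : ℝ≥0∞) [Fact (1 ≤ p)] (e : Fin n → E) : 0 ≤ strongNorm p e :=
  norm_nonneg (WithLp.toLp p e : PiLp p fun _ : Fin n => E)

theorem strongNorm_add_le (p : ℝ≥0∞) [Fact (1 ≤ p)] (e f : Fin n → E) :
    strongNorm p (e + f) ≤ strongNorm p e + strongNorm p f :=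
  norm_add_le (WithLp.toLp p e : PiLp p fun _ : Fin n => E) (WithLp.toLp p f)

theorem strongNorm_smul [NormedSpace ℝ E] (p : ℝ≥0∞) [Fact (1 ≤ p)] (c : ℝ) (e : Fin n → E) :
    strongNorm p (c • e) = |c| * strongNorm p e :=
  norm_smul c (WithLp.toLp p e : PiLp p fun _ : Fin n => E)

theorem strongNorm_mono (p : ℝ≥0∞) [Fact (1 ≤ p)] {e : Fin n → E} {f : Fin n → F}
    (h : ∀ i, ‖e i‖ ≤ ‖f i‖) : strongNorm p e ≤ strongNorm p f := by
  rcases p.dichotomy with rfl | hp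
  · exact ciSup_mono (Set.finite_range _).bddAbove h
  · have hp' : 0 < p.toReal := by linarith
    rw [strongNorm_eq_sum hp', strongNorm_eq_sum hp']
    gcongr with i
    exact h i

theorem strongNorm_congr (p : ℝ≥0∞) [Fact (1 ≤ p)] {e : Fin n → E} {f : Fin n → F}
    (h : ∀ i, ‖e i‖ = ‖f i‖) : strongNorm p e = strongNorm p f :=
  le_antisymm (strongNorm_mono p fun i => (h i).le) (strongNorm_mono p fun i => (h i).ge)

theorem sum_norm_mul_norm_le_top_one (e : Fin n → E) (f : Fin n → F) :
    ∑ i, ‖e i‖ * ‖f i‖ ≤ strongNorm ∞ e * strongNorm 1 f := by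
  rw [strongNorm_one, Finset.mul_sum]
  gcongr with i
  exact le_ciSup (Set.finite_range fun i => ‖e i‖).bddAbove i

/-- Hölder's inequality, including the endpoints `1` and `∞`. -/
theorem sum_norm_mul_norm_le (p q : ℝ≥0∞) [p.HolderConjugate q] (e : Fin n → E) (f : Fin n → F) :
    ∑ i, ‖e i‖ * ‖f i‖ ≤ strongNorm p e * strongNorm q f := by
  by_cases hp : p = ∞
  · subst hp
    obtain rfl := ENNReal.HolderConjugate.unique ∞ q 1
    exact sum_norm_mul_norm_le_top_one e f
  by_cases hq : q = ∞
  · subst hq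
    obtain rfl := ENNReal.HolderConjugate.unique ∞ p 1
    rw [mul_comm (strongNorm _ e)]
    simpa only [mul_comm] using sum_norm_mul_norm_le_top_one f e
  have h := ENNReal.HolderConjugate.toReal_of_ne_top hp hq
  rw [strongNorm_eq_sum h.pos, strongNorm_eq_sum h.symm.pos]
  exact Real.inner_le_Lp_mul_Lq_of_nonneg _ h (fun i _ => norm_nonneg _) fun i _ => norm_nonneg _

/-- The `ℓ_p` norm of a finite family is attained on the unit ball of the dual exponent. -/
theorem exists_sum_mul_norm_eq (p q : ℝ≥0∞) [p.HolderConjugate q] (e : Fin n → E) :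
    ∃ a : Fin n → ℝ, (∀ i, 0 ≤ a i) ∧ strongNorm q a ≤ 1 ∧
      ∑ i, a i * ‖e i‖ = strongNorm p e := by
  by_cases hp : p = ∞
  · subst hp
    obtain rfl := ENNReal.HolderConjugate.unique ∞ q 1
    rcases isEmpty_or_nonempty (Fin n) with hn | hn
    · exact ⟨0, fun _ => le_rfl, by simp [strongNorm_one], by simp [strongNorm_top]⟩
    obtain ⟨j, hj⟩ := exists_eq_ciSup_of_finite (f := fun i => ‖e i‖)
    refine ⟨Pi.single j 1, fun i => ?_, ?_, ?_⟩
    · by_cases h : i = j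
      · subst h; simp
      · simp [h]
    · rw [strongNorm_one, Finset.sum_eq_single j] <;> simp +contextual
    · rw [strongNorm_top, ← hj, Finset.sum_eq_single j] <;> simp +contextual
  by_cases hq : q = ∞
  · subst hq
    obtain rfl := ENNReal.HolderConjugate.unique ∞ p 1
    refine ⟨1, fun _ => zero_le_one, ?_, by simp [strongNorm_one]⟩
    rw [strongNorm_top]
    exact Real.iSup_le (fun i => by simp) zero_le_one
  have h := ENNReal.HolderConjugate.toReal_of_ne_top hp hq
  obtain ⟨a, ha, hae⟩ := (NNReal.isGreatest_Lp Finset.univ (fun i => ‖e i‖₊) h).1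
  refine ⟨fun i => a i, fun i => (a i).2, ?_, ?_⟩
  · rw [strongNorm_eq_sum h.symm.pos]
    refine Real.rpow_le_one (by positivity) ?_ (by have := h.symm.pos; positivity)
    have ha' : ∑ i, a i ^ q.toReal ≤ 1 := ha
    simpa using (NNReal.coe_le_coe.2 ha')
  · rw [strongNorm_eq_sum h.pos]
    have := congrArg NNReal.toReal hae
    push_cast at this
    simpa [mul_comm] using this

theorem continuous_strongNorm (p : ℝ≥0∞) [Fact (1 ≤ p)] :
    Continuous fun e : Fin n → E => strongNorm p e :=
  continuous_norm.comp (PiLp.continuous_toLp p fun _ : Fin n => E)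

variable [NormedSpace ℝ E] [NormedSpace ℝ F]

theorem strongNorm_apply_le (p : ℝ≥0∞) [Fact (1 ≤ p)] (φ : StrongDual ℝ E) (e : Fin n → E) :
    strongNorm p (fun i => φ (e i)) ≤ ‖φ‖ * strongNorm p e := by
  rw [← abs_of_nonneg (norm_nonneg φ), ← strongNorm_smul]
  refine strongNorm_mono p fun i => ?_
  rw [Pi.smul_apply, norm_smul, norm_norm]
  exact φ.le_opNorm _

/-- The numbers `‖(φ(e_i))‖_p`, for `φ` in the dual unit ball, are bounded by the strong norm of
`e`, so their supremum is a genuine one. -/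
theorem strongNorm_apply_le_weakNorm (p : ℝ≥0∞) [Fact (1 ≤ p)] (φ : StrongDual ℝ E)
    (e : Fin n → E) : strongNorm p (fun i => φ (e i)) ≤ ‖φ‖ * weakNorm p e := by
  have unit : ∀ ψ : StrongDual ℝ E, ‖ψ‖ ≤ 1 → strongNorm p (fun i => ψ (e i)) ≤ weakNorm p e := by
    intro ψ hψ
    refine le_csSup ⟨strongNorm p e, ?_⟩ ⟨ψ, hψ, rfl⟩
    rintro r ⟨χ, hχ, rfl⟩
    exact (strongNorm_apply_le p χ e).trans
      (mul_le_of_le_one_left (strongNorm_nonneg p e) hχ)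
  rcases eq_or_ne φ 0 with rfl | hφ
  · exact (strongNorm_apply_le p 0 e).trans_eq (by simp)
  · have h := unit (‖φ‖⁻¹ • φ) (by rw [norm_smul, norm_inv, norm_norm,
      inv_mul_cancel₀ (norm_ne_zero_iff.2 hφ)])
    have h' : strongNorm p (fun i => (‖φ‖⁻¹ • φ) (e i)) =
        ‖φ‖⁻¹ * strongNorm p (fun i => φ (e i)) := by
      rw [← abs_of_nonneg (inv_nonneg.2 (norm_nonneg φ)), ← strongNorm_smul]
      rw [abs_of_nonneg (inv_nonneg.2 (norm_nonneg φ))]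
      rfl
    rwa [h', inv_mul_le_iff₀ (norm_pos_iff.2 hφ)] at h

theorem weakNorm_nonneg (p : ℝ≥0∞) [Fact (1 ≤ p)] (e : Fin n → E) : 0 ≤ weakNorm p e := by
  refine Real.sSup_nonneg ?_
  rintro r ⟨φ, -, rfl⟩
  exact strongNorm_nonneg p _

theorem weakNorm_le {p : ℝ≥0∞} {e : Fin n → E} {C : ℝ} (hC : 0 ≤ C)
    (h : ∀ φ : StrongDual ℝ E, ‖φ‖ ≤ 1 → strongNorm p (fun i => φ (e i)) ≤ C) :
    weakNorm p e ≤ C := by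
  refine Real.sSup_le ?_ hC
  rintro r ⟨φ, hφ, rfl⟩
  exact h φ hφ

theorem weakNorm_add_le (p : ℝ≥0∞) [Fact (1 ≤ p)] (e f : Fin n → E) :
    weakNorm p (e + f) ≤ weakNorm p e + strongNorm p f := by
  refine weakNorm_le (add_nonneg (weakNorm_nonneg p e) (strongNorm_nonneg p f)) fun φ hφ => ?_
  have h : (fun i => φ ((e + f) i)) = (fun i => φ (e i)) + fun i => φ (f i) := by
    ext i
    simp
  rw [h]
  exact (strongNorm_add_le p _ _).trans (add_le_add
    ((strongNorm_apply_le_weakNorm p φ e).trans (mul_le_of_le_one_left (weakNorm_nonneg p e) hφ))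
    ((strongNorm_apply_le p φ f).trans (mul_le_of_le_one_left (strongNorm_nonneg p f) hφ)))

theorem weakNorm_map_le (p : ℝ≥0∞) [Fact (1 ≤ p)] (R : E →L[ℝ] F) (hR : ‖R‖ ≤ 1)
    (e : Fin n → E) : weakNorm p (fun i => R (e i)) ≤ weakNorm p e := by
  refine weakNorm_le (weakNorm_nonneg p e) fun φ hφ => ?_
  refine (strongNorm_apply_le_weakNorm p (φ.comp R) e).trans
    (mul_le_of_le_one_left (weakNorm_nonneg p e) ?_)
  exact (φ.opNorm_comp_le R).trans (mul_le_one₀ hφ (norm_nonneg R) hR)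

theorem continuous_weakNorm (p : ℝ≥0∞) [Fact (1 ≤ p)] :
    Continuous fun e : Fin n → E => weakNorm p e := by
  refine continuous_iff_continuousAt.2 fun e => tendsto_iff_dist_tendsto_zero.2 ?_
  have h0 : Filter.Tendsto (fun f : Fin n → E => strongNorm p (f - e)) (nhds e) (nhds 0) := by
    have := ((continuous_strongNorm p).comp (continuous_id.sub continuous_const)).tendsto
      (f := fun f : Fin n → E => strongNorm p (f - e)) e
    have hz : strongNorm p (0 : Fin n → E) = 0 := norm_zero (E := PiLp p fun _ : Fin n => E)
    simpa [hz] using this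
  refine squeeze_zero (fun _ => dist_nonneg) (fun f => ?_) h0
  have h1 := weakNorm_add_le p e (f - e)
  have h2 := weakNorm_add_le p f (e - f)
  rw [add_sub_cancel] at h1 h2
  have h3 : strongNorm p (e - f) = strongNorm p (f - e) :=
    strongNorm_congr p fun i => norm_sub_rev _ _
  rw [Real.dist_eq, abs_le]
  constructor <;> linarith

end Norms

/-! ### Functionals bounded by the weak norm -/

theorem exists_norm_le_two_mul_apply {E : Type*} [NormedAddCommGroup E] [NormedSpace ℝ E]
    (f : StrongDual ℝ E) : ∃ x : E, ‖x‖ ≤ 1 ∧ ‖f‖ ≤ 2 * f x := by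
  rcases eq_or_ne f 0 with rfl | hf
  · exact ⟨0, by simp, by simp⟩
  obtain ⟨x, hx, hfx⟩ := f.exists_lt_apply_of_lt_opNorm (half_lt_self (norm_pos_iff.2 hf))
  rw [Real.norm_eq_abs] at hfx
  rcases le_total 0 (f x) with h | h
  · rw [abs_of_nonneg h] at hfx
    exact ⟨x, hx.le, by linarith⟩
  · rw [abs_of_nonpos h] at hfx
    exact ⟨-x, by simpa using hx.le, by rw [map_neg]; linarith⟩

/-- By compactness of the dual ball, finitely many functionals norm a finite-dimensional space up
to a factor `2`. -/
theorem exists_finset_norm_le_two_mul_abs_apply (V : Type*) [NormedAddCommGroup V]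
    [NormedSpace ℝ V] [FiniteDimensional ℝ V] :
    ∃ s : Finset (StrongDual ℝ V), (∀ ψ ∈ s, ‖ψ‖ ≤ 1) ∧ ∀ v, ∃ ψ ∈ s, ‖v‖ ≤ 2 * |ψ v| := by
  have : ProperSpace (StrongDual ℝ V) := FiniteDimensional.proper ℝ _
  obtain ⟨t, hts, htf, hcov⟩ := (isCompact_closedBall (0 : StrongDual ℝ V) 1).finite_cover_balls
    (e := 1 / 2) (by norm_num)
  refine ⟨htf.toFinset, fun ψ hψ => ?_, fun v => ?_⟩
  · simpa using hts (htf.mem_toFinset.1 hψ)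
  · obtain ⟨χ, hχ, hχv⟩ := exists_dual_vector'' ℝ v
    obtain ⟨ψ, hψ, hd⟩ : ∃ ψ ∈ t, χ ∈ Metric.ball ψ (1 / 2) := by
      simpa using hcov (by simpa using hχ : χ ∈ Metric.closedBall 0 1)
    refine ⟨ψ, htf.mem_toFinset.2 hψ, ?_⟩
    have h1 : |(χ - ψ) v| ≤ 1 / 2 * ‖v‖ := by
      refine ((χ - ψ).le_opNorm v).trans ?_
      rw [Metric.mem_ball, dist_eq_norm] at hd
      gcongr
    have h2 : χ v = ‖v‖ := hχv
    rw [sub_apply, h2] at h1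
    have h3 := abs_le.1 h1
    have h4 := le_abs_self (ψ v)
    linarith

theorem dual_piLp_apply {p : ℝ≥0∞} [Fact (1 ≤ p)] {n : ℕ}
    (ψ : StrongDual ℝ (PiLp p fun _ : Fin n => ℝ)) (v : Fin n → ℝ) :
    ψ (WithLp.toLp p v) = ∑ i, ψ (PiLp.single p i 1) * v i := by
  have h : WithLp.toLp p v = ∑ i, v i • (PiLp.single p i 1 : PiLp p fun _ : Fin n => ℝ) := by
    ext j
    simp [Pi.single_apply]
  rw [h, map_sum]
  simp [mul_comm]

/-- A functional `m ↦ ∑ ℓ_i(m_i)` on `E^n` that is bounded for the weak `ℓ_p` norm is carried by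
finitely many elements of the dual of `ℓ_p^n`, with coefficients in `E*` whose norms have a sum
bounded independently of `n`. The weak norm of `m` is at most
`2 max_ψ ‖∑ ψ(single i) m_i‖`, for `ψ` in a finite set that norms `ℓ_p^n` up to a factor `2`, so
the functional extends by Hahn–Banach to the space of families `(w_ψ)` in `E` with the
maximum norm. -/
theorem exists_dual_decomposition (p : ℝ≥0∞) [Fact (1 ≤ p)] {E : Type*} [NormedAddCommGroup E]
    [NormedSpace ℝ E] {n : ℕ} (ℓ : Fin n → StrongDual ℝ E) {C : ℝ} (hC : 0 ≤ C)
    (hℓ : ∀ m : Fin n → E, |∑ i, ℓ i (m i)| ≤ C * weakNorm p m) :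
    ∃ (s : Finset (StrongDual ℝ (PiLp p fun _ : Fin n => ℝ))) (h : s → StrongDual ℝ E),
      (∀ ψ ∈ s, ‖ψ‖ ≤ 1) ∧ ∑ ψ, ‖h ψ‖ ≤ 4 * C ∧
        ∀ i, ℓ i = ∑ ψ : s, ψ.1 (PiLp.single p i 1) • h ψ := by
  obtain ⟨s, hs, hnorm⟩ := exists_finset_norm_le_two_mul_abs_apply (PiLp p fun _ : Fin n => ℝ)
  let A : (Fin n → E) →ₗ[ℝ] (s → E) :=
    LinearMap.pi fun ψ => ∑ i, ψ.1 (PiLp.single p i 1) • LinearMap.proj i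
  have hA : ∀ m ψ, A m ψ = ∑ i, ψ.1 (PiLp.single p i 1) • m i := fun m ψ => by simp [A]
  let L : Module.Dual ℝ (Fin n → E) := ∑ i, (ℓ i).toLinearMap.comp (LinearMap.proj i)
  have hL : ∀ m, L m = ∑ i, ℓ i (m i) := fun m => by simp [L]
  have hweak : ∀ m, weakNorm p m ≤ 2 * ‖A m‖ := by
    intro m
    refine weakNorm_le (by positivity) fun φ hφ => ?_
    obtain ⟨ψ, hψ, hle⟩ := hnorm (WithLp.toLp p fun i => φ (m i))
    refine hle.trans ?_
    have h1 : ψ (WithLp.toLp p fun i => φ (m i)) = φ (A m ⟨ψ, hψ⟩) := by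
      rw [dual_piLp_apply, hA, map_sum]
      simp
    rw [h1]
    gcongr
    calc |φ (A m ⟨ψ, hψ⟩)| ≤ ‖φ‖ * ‖A m ⟨ψ, hψ⟩‖ := φ.le_opNorm _
      _ ≤ 1 * ‖A m‖ := by
        gcongr
        exact norm_le_pi_norm (A m) _
      _ = ‖A m‖ := one_mul _
  have hbound : ∀ m, |L m| ≤ 2 * C * ‖A m‖ := fun m => by
    rw [hL, mul_comm 2 C, mul_assoc]
    exact (hℓ m).trans (mul_le_mul_of_nonneg_left (hweak m) hC)
  -- By the bound, `L` vanishes on the kernel of `A`, so it factors through `A`.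
  obtain ⟨f, hf⟩ : L ∈ LinearMap.range A.dualMap := by
    rw [LinearMap.range_dualMap_eq_dualAnnihilator_ker, Submodule.mem_dualAnnihilator]
    intro m hm
    have := hbound m
    rw [LinearMap.mem_ker.1 hm, norm_zero, mul_zero] at this
    exact abs_nonpos_iff.1 this
  let c : ℝ≥0 := ⟨2 * C, by positivity⟩
  obtain ⟨g, hg, hgle⟩ := Module.Dual.exists_extension_of_le_seminorm_real (LinearMap.range A)
    (f.domRestrict (LinearMap.range A))
    (p := c • normSeminorm ℝ (s → E)) (by
      rintro ⟨_, m, rfl⟩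
      have : f (A m) = L m := by rw [← hf]; rfl
      change f (A m) ≤ 2 * C * ‖A m‖
      rw [this]
      exact (le_abs_self _).trans (hbound m))
  let G : StrongDual ℝ (s → E) := LinearMap.mkContinuous g (2 * C) hgle
  have hGA : ∀ m, G (A m) = ∑ i, ℓ i (m i) := fun m => by
    rw [← hL, ← hf]
    exact hg ⟨A m, m, rfl⟩
  classical
  let h : s → StrongDual ℝ E := fun ψ => G.comp (ContinuousLinearMap.single ℝ (fun _ : s => E) ψ)
  have hG : ∀ w, G w = ∑ ψ, h ψ (w ψ) := fun w => by
    conv_lhs => rw [← Finset.univ_sum_single w, map_sum]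
    rfl
  refine ⟨s, h, hs, ?_, fun i => ?_⟩
  · choose x hx hhx using fun ψ => exists_norm_le_two_mul_apply (h ψ)
    have h1 : G x ≤ 2 * C := by
      refine (le_abs_self _).trans ((hgle x).trans ?_)
      change 2 * C * ‖x‖ ≤ 2 * C
      exact mul_le_of_le_one_right (by positivity) ((pi_norm_le_iff_of_nonneg zero_le_one).2 hx)
    calc ∑ ψ, ‖h ψ‖ ≤ ∑ ψ, 2 * h ψ (x ψ) := Finset.sum_le_sum fun ψ _ => hhx ψ
      _ = 2 * G x := by rw [hG, Finset.mul_sum]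
      _ ≤ 4 * C := by linarith
  · ext e
    have h1 := hGA (Pi.single i e)
    rw [Finset.sum_eq_single i (fun j _ hj => by simp [hj]) (by simp), Pi.single_eq_same, hG] at h1
    rw [← h1, sum_apply]
    refine Finset.sum_congr rfl fun ψ _ => ?_
    rw [hA, Finset.sum_eq_single i (fun j _ hj => by simp [hj]) (by simp), Pi.single_eq_same,
      map_smul]
    rfl

/-- A bound of `∑ ℓ_i(m_i)` by the weak norm of `m`, for `m` in `E^n`, extends with four times the
constant to families `φ` in the bidual of `E`. The dual of `E` is allowed to be mapped to another
space `G` by a contraction `D`, with `φ` in the dual of `G`. -/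
theorem sum_apply_dual_le (p : ℝ≥0∞) [Fact (1 ≤ p)] {E G : Type*} [NormedAddCommGroup E]
    [NormedSpace ℝ E] [NormedAddCommGroup G] [NormedSpace ℝ G] (D : StrongDual ℝ E →L[ℝ] G)
    (hD : ‖D‖ ≤ 1) {n : ℕ} (ℓ : Fin n → StrongDual ℝ E) {C : ℝ} (hC : 0 ≤ C)
    (hℓ : ∀ m : Fin n → E, |∑ i, ℓ i (m i)| ≤ C * weakNorm p m) (φ : Fin n → StrongDual ℝ G) :
    ∑ i, φ i (D (ℓ i)) ≤ 4 * C * weakNorm p φ := by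
  obtain ⟨s, h, hs, hsum, hdec⟩ := exists_dual_decomposition p ℓ hC hℓ
  have hterm : ∀ ψ : s, ψ.1 (WithLp.toLp p fun i => φ i (D (h ψ))) ≤ ‖h ψ‖ * weakNorm p φ := by
    intro ψ
    refine (le_abs_self _).trans ((ψ.1.le_opNorm _).trans ?_)
    refine (mul_le_of_le_one_left (norm_nonneg _) (hs ψ ψ.2)).trans ?_
    refine (strongNorm_apply_le_weakNorm p
      (NormedSpace.inclusionInDoubleDual ℝ G (D (h ψ))) φ).trans ?_
    gcongr
    · exact weakNorm_nonneg p φ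
    · refine (NormedSpace.double_dual_bound ℝ G _).trans ((D.le_opNorm _).trans ?_)
      exact mul_le_of_le_one_left (norm_nonneg _) hD
  calc ∑ i, φ i (D (ℓ i)) = ∑ ψ : s, ψ.1 (WithLp.toLp p fun i => φ i (D (h ψ))) := by
        simp_rw [dual_piLp_apply, hdec, map_sum, map_smul, smul_eq_mul]
        exact Finset.sum_comm
    _ ≤ ∑ ψ : s, ‖h ψ‖ * weakNorm p φ := Finset.sum_le_sum fun ψ _ => hterm ψ
    _ = (∑ ψ : s, ‖h ψ‖) * weakNorm p φ := (Finset.sum_mul ..).symm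
    _ ≤ 4 * C * weakNorm p φ := mul_le_mul_of_nonneg_right hsum (weakNorm_nonneg p φ)

noncomputable section

/-! ### The trace pairing of `F(X)` and `Y^#` -/

/-- Bounded linear operators between normed spaces, with the linear and topological structures
taken from the norms. For a subspace such as `F(X)` these agree with the structures inherited from
the ambient space only after unfolding, and instance search has to be told which to use. -/
abbrev NormedHom (E F : Type*) [NormedAddCommGroup E] [NormedSpace ℝ E] [NormedAddCommGroup F]
    [NormedSpace ℝ F] : Type _ :=
  E →L[ℝ] F

section Pairing

variable {X Y : Type*} [MetricSpace X] [MetricSpace Y] {x₀ : X} {y₀ : Y} (T : X → Y) {K : ℝ≥0}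
  (hT : LipschitzWith K T) (hT₀ : T x₀ = y₀)

/-- The estimate `|∑ ⟨m_i, T^# g_i⟩| ≤ C ‖(m_i)‖_{p,w} ‖(g_i)‖_{p*}` for finite families in `F(X)`
and `Y^#`, with a constant independent of the families. -/
def IsPairingBounded (p : ℝ≥0∞) : Prop :=
  ∃ C : ℝ, 0 < C ∧ ∀ (n : ℕ) (m : Fin n → ↥(lipFree x₀)) (g : Fin n → LipDual y₀),
    |∑ i, (m i).1 (lipAdjoint T hT hT₀ (g i))| ≤ C * weakNorm p m * strongNorm p.conjExponent g

/-- The inclusion of `F(X)` in the dual of `X^#`. -/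
def freeInclusion (x₀ : X) : NormedHom ↥(lipFree x₀) (StrongDual ℝ (LipDual x₀)) :=
  LinearMap.mkContinuous
    { toFun := Subtype.val
      map_add' := fun _ _ => rfl
      map_smul' := fun _ _ => rfl }
    1 fun m => (one_mul ‖m‖).ge

theorem norm_freeInclusion_le (x₀ : X) : ‖freeInclusion x₀‖ ≤ 1 :=
  LinearMap.mkContinuous_norm_le _ zero_le_one _

theorem norm_freeDelta_le (x₀ x y : X) : ‖freeDelta x₀ x y‖ ≤ dist x y :=
  (delta x₀ x y).opNorm_le_bound dist_nonneg fun f =>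
    (f.norm_sub_le x y).trans_eq (mul_comm _ _)

theorem freeDelta_self (x₀ x : X) : freeDelta x₀ x x = 0 := by
  ext f
  exact sub_self (f x)

theorem freeDelta_sub_freeDelta (x₀ x y z : X) :
    freeDelta x₀ x z - freeDelta x₀ y z = freeDelta x₀ x y := by
  ext f
  change (f x - f z) - (f y - f z) = f x - f y
  ring

theorem norm_apply_freeDelta_sub_le (h : NormedHom ↥(lipFree x₀) ℝ) (x y : X) :
    ‖h (freeDelta x₀ x x₀) - h (freeDelta x₀ y x₀)‖ ≤ ‖h‖ * dist x y := by
  rw [← map_sub, freeDelta_sub_freeDelta]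
  exact (h.le_opNorm _).trans (by gcongr; exact norm_freeDelta_le x₀ x y)

/-- The operator `F(X)* → X^#` that sends a functional `h` to the function
`x ↦ h(δ_(x,x₀))`. -/
def freeDualToLip (x₀ : X) : NormedHom (NormedHom ↥(lipFree x₀) ℝ) (LipDual x₀) :=
  LinearMap.mkContinuous
    { toFun := fun h => LipZero.mk (fun x => h (freeDelta x₀ x x₀))
        ((congrArg h (freeDelta_self x₀ x₀)).trans h.map_zero)
        ⟨‖h‖₊, LipschitzWith.of_dist_le_mul fun x y =>
          (dist_eq_norm _ _).trans_le (norm_apply_freeDelta_sub_le h x y)⟩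
      map_add' := fun f g => rfl
      map_smul' := fun c f => rfl }
    1 fun h => by
      rw [one_mul]
      exact LipZero.norm_le_of_bound _ (norm_nonneg h) (norm_apply_freeDelta_sub_le h)

theorem norm_freeDualToLip_le (x₀ : X) : ‖freeDualToLip x₀‖ ≤ 1 :=
  (freeDualToLip x₀).opNorm_le_bound zero_le_one fun h => by
    rw [one_mul]
    exact LipZero.norm_le_of_bound _ (norm_nonneg h) (norm_apply_freeDelta_sub_le h)

variable {T hT hT₀} {p : ℝ≥0∞}

/-! ### The Lipschitz tensor product -/

/-- The bilinear form `(m, g) ↦ ⟨m, T^# g⟩`, as a linear form on `F(X) ⊗ Y^#`. -/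
def tensorPairing (T : X → Y) (hT : LipschitzWith K T) (hT₀ : T x₀ = y₀) :
    ↥(lipFree x₀) ⊗[ℝ] LipDual y₀ →ₗ[ℝ] ℝ :=
  TensorProduct.lift (LinearMap.mk₂ ℝ
    (fun (m : ↥(lipFree x₀)) (g : LipDual y₀) => m.1 (lipAdjoint T hT hT₀ g))
    (fun _ _ _ => rfl) (fun _ _ _ => rfl) (fun m g g' => by rw [map_add, map_add])
    (fun c m g => by rw [map_smul, map_smul]))

theorem tensorPairing_tmul (m : ↥(lipFree x₀)) (g : LipDual y₀) :
    tensorPairing T hT hT₀ (m ⊗ₜ g) = m.1 (lipAdjoint T hT hT₀ g) := by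
  simp [tensorPairing]

/-- The Lipschitz map `x ↦ δ_(Tx,y₀)` from `X` to the dual of `Y^#`. -/
def deltaComp (T : X → Y) (hT : LipschitzWith K T) (hT₀ : T x₀ = y₀) :
    LipZero x₀ (StrongDual ℝ (LipDual y₀)) :=
  LipZero.mk (fun x => delta y₀ (T x) y₀) (by ext g; simp [hT₀])
    ⟨K, LipschitzWith.of_dist_le_mul fun x y => by
      have h : delta y₀ (T x) y₀ - delta y₀ (T y) y₀ = delta y₀ (T x) (T y) :=
        congrArg Subtype.val (freeDelta_sub_freeDelta y₀ (T x) (T y) y₀)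
      rw [dist_eq_norm, h]
      exact (norm_freeDelta_le y₀ (T x) (T y)).trans (hT.dist_le_mul x y)⟩

theorem box_deltaComp (x y : X) (g : LipDual y₀) :
    (box x₀ x y g).1 (deltaComp T hT hT₀) = g (T x) - g (T y) := by
  change (g (T x) - g y₀) - (g (T y) - g y₀) = _
  ring

/-- Evaluating `u ∈ X ⊠ Y^#` at `x ↦ δ_(Tx,y₀)` is the trace pairing of any tensor that
corresponds to `u`. -/
theorem tensorPairing_eq_of_mem {u : ↥(lipTensor x₀ (LipDual y₀))}
    {t : ↥(lipFree x₀) ⊗[ℝ] LipDual y₀} (ht : t ∈ tensorsOf u) :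
    tensorPairing T hT hT₀ t = u.1 (deltaComp T hT hT₀) := by
  obtain ⟨l, x, y, s, rfl, rfl⟩ := ht
  rw [map_sum, AddSubmonoidClass.coe_finsetSum, LinearMap.sum_apply]
  refine Finset.sum_congr rfl fun k _ => ?_
  rw [tensorPairing_tmul, box_deltaComp]
  rfl

theorem sum_box_deltaComp {l : ℕ} (x y : Fin l → X) (g : Fin l → LipDual y₀) :
    (∑ k, box x₀ (x k) (y k) (g k)).1 (deltaComp T hT hT₀) =
      ∑ k, (g k (T (x k)) - g k (T (y k))) := by
  rw [AddSubmonoidClass.coe_finsetSum, LinearMap.sum_apply]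
  exact Finset.sum_congr rfl fun k _ => box_deltaComp _ _ _

theorem sum_tmul_mem_tensorsOf {E : Type*} [NormedAddCommGroup E] [NormedSpace ℝ E] {l : ℕ}
    (x y : Fin l → X) (s : Fin l → E) :
    ∑ k, freeDelta x₀ (x k) (y k) ⊗ₜ[ℝ] s k ∈ tensorsOf (∑ k, box x₀ (x k) (y k) (s k)) :=
  ⟨l, x, y, s, rfl, rfl⟩

theorem IsPairingBounded.isMStrictlyLipschitzSumming (h : IsPairingBounded T hT hT₀ p) :
    IsMStrictlyLipschitzSumming p x₀ y₀ T := by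
  obtain ⟨C, hC, hb⟩ := h
  refine ⟨C, hC, fun l x y g => ?_⟩
  rw [← div_le_iff₀' hC]
  refine le_csInf ⟨_, l, _, g, sum_tmul_mem_tensorsOf x y g, rfl⟩ ?_
  rintro r ⟨n, m, e, hme, rfl⟩
  rw [div_le_iff₀' hC, ← sum_box_deltaComp (hT := hT) (hT₀ := hT₀), ← tensorPairing_eq_of_mem hme,
    map_sum, ← mul_assoc]
  simp_rw [tensorPairing_tmul]
  exact hb n m e

variable [Fact (1 ≤ p)]

instance fact_one_le_conjExponent : Fact (1 ≤ p.conjExponent) :=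
  ⟨ENNReal.HolderConjugate.one_le _ p⟩

/-- Every representation bounds `d_p^L(u)` from above: the infimum is over a set of nonnegative
numbers. -/
theorem lipCrossNorm_le {E : Type*} [NormedAddCommGroup E] [NormedSpace ℝ E]
    {u : ↥(lipTensor x₀ E)} {n : ℕ} {m : Fin n → ↥(lipFree x₀)} {e : Fin n → E}
    (h : ∑ i, m i ⊗ₜ[ℝ] e i ∈ tensorsOf u) :
    lipCrossNorm p u ≤ weakNorm p m * strongNorm p.conjExponent e := by
  refine csInf_le ⟨0, ?_⟩ ⟨n, m, e, h, rfl⟩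
  rintro r ⟨n, m, e, -, rfl⟩
  exact mul_nonneg (weakNorm_nonneg p m) (strongNorm_nonneg _ e)

/-- The (not closed) linear span of the `δ_(x,y)` in `F(X)`. -/
def deltaSpan (x₀ : X) : Submodule ℝ ↥(lipFree x₀) :=
  Submodule.span ℝ (Set.range fun q : X × X => freeDelta x₀ q.1 q.2)

theorem dense_deltaSpan : Dense (deltaSpan x₀ : Set ↥(lipFree x₀)) := by
  rw [Subtype.dense_iff]
  have h : ((↑) '' (deltaSpan x₀ : Set ↥(lipFree x₀)) : Set (StrongDual ℝ (LipDual x₀))) =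
      Submodule.span ℝ (Set.range fun q : X × X => delta x₀ q.1 q.2) := by
    have := Submodule.map_span (lipFree x₀).subtype
      (Set.range fun q : X × X => freeDelta x₀ q.1 q.2)
    rw [← Set.range_comp] at this
    exact congrArg SetLike.coe this
  intro v hv
  exact h ▸ hv

theorem exists_tmul_eq_sum_freeDelta {E : Type*} [NormedAddCommGroup E] [NormedSpace ℝ E]
    {m : ↥(lipFree x₀)} (hm : m ∈ deltaSpan x₀) (e : E) :
    ∃ (l : ℕ) (x y : Fin l → X) (s : Fin l → E),
      m ⊗ₜ[ℝ] e = ∑ k, freeDelta x₀ (x k) (y k) ⊗ₜ[ℝ] s k := by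
  obtain ⟨l, c, w, rfl⟩ := Submodule.mem_span_set'.1 hm
  choose q hq using fun k => (w k).2
  refine ⟨l, fun k => (q k).1, fun k => (q k).2, fun k => c k • e, ?_⟩
  rw [TensorProduct.sum_tmul]
  refine Finset.sum_congr rfl fun k _ => ?_
  rw [TensorProduct.smul_tmul, ← hq k]

theorem exists_sum_tmul_eq_sum_freeDelta {E : Type*} [NormedAddCommGroup E] [NormedSpace ℝ E] {n : ℕ}
    {m : Fin n → ↥(lipFree x₀)} (hm : ∀ i, m i ∈ deltaSpan x₀) (e : Fin n → E) :
    ∃ (l : ℕ) (x y : Fin l → X) (s : Fin l → E),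
      ∑ i, m i ⊗ₜ[ℝ] e i = ∑ k, freeDelta x₀ (x k) (y k) ⊗ₜ[ℝ] s k := by
  choose l x y s h using fun i => exists_tmul_eq_sum_freeDelta (hm i) (e i)
  refine ⟨_, fun k => x _ (finSigmaFinEquiv.symm k).2, fun k => y _ (finSigmaFinEquiv.symm k).2,
    fun k => s _ (finSigmaFinEquiv.symm k).2, ?_⟩
  rw [finSigmaFinEquiv.symm.sum_comp
    (fun k : (i : Fin n) × Fin (l i) => freeDelta x₀ (x k.1 k.2) (y k.1 k.2) ⊗ₜ[ℝ] s k.1 k.2),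
    Fintype.sum_sigma]
  exact Finset.sum_congr rfl fun i _ => h i

theorem IsMStrictlyLipschitzSumming.isPairingBounded
    (h : IsMStrictlyLipschitzSumming p x₀ y₀ T) : IsPairingBounded T hT hT₀ p := by
  obtain ⟨C, hC, hb⟩ := h
  refine ⟨C, hC, fun n m g => ?_⟩
  have hdense : Dense {m : Fin n → ↥(lipFree x₀) | ∀ i, m i ∈ deltaSpan x₀} := by
    simpa [Set.pi] using dense_pi Set.univ (fun (_ : Fin n) _ => dense_deltaSpan (x₀ := x₀))
  have hclosed : IsClosed {m : Fin n → ↥(lipFree x₀) |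
      |∑ i, (m i).1 (lipAdjoint T hT hT₀ (g i))| ≤
        C * weakNorm p m * strongNorm p.conjExponent g} := by
    refine isClosed_le ?_ ((continuous_const.mul (continuous_weakNorm p)).mul continuous_const)
    refine (continuous_finsetSum _ fun i _ => ?_).abs
    exact (ContinuousLinearMap.apply ℝ ℝ (lipAdjoint T hT hT₀ (g i))).continuous.comp
      (continuous_subtype_val.comp (continuous_apply i))
  refine hclosed.closure_subset_iff.2 (fun m hm => ?_) (hdense m)
  obtain ⟨l, x, y, s, hs⟩ := exists_sum_tmul_eq_sum_freeDelta hm g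
  have hmem : ∑ i, m i ⊗ₜ[ℝ] g i ∈ tensorsOf (∑ k, box x₀ (x k) (y k) (s k)) :=
    hs ▸ sum_tmul_mem_tensorsOf x y s
  have hpair : ∑ i, (m i).1 (lipAdjoint T hT hT₀ (g i)) =
      ∑ k, (s k (T (x k)) - s k (T (y k))) := by
    rw [← sum_box_deltaComp (hT := hT) (hT₀ := hT₀), ← tensorPairing_eq_of_mem hmem, map_sum]
    simp_rw [tensorPairing_tmul]
  rw [Set.mem_ofPred_eq, hpair, mul_assoc]
  exact (hb l x y s).trans (mul_le_mul_of_nonneg_left (lipCrossNorm_le hmem) hC.le)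

/-! ### Summing linearizations -/

theorem IsSumming.isPairingBounded
    (h : IsSumming (E := ↥(lipFree x₀)) (F := ↥(lipFree y₀)) p (linearization T hT hT₀)) :
    IsPairingBounded T hT hT₀ p := by
  obtain ⟨C, hC, hb⟩ := h
  refine ⟨C, hC, fun n m g => ?_⟩
  calc |∑ i, (m i).1 (lipAdjoint T hT hT₀ (g i))|
      ≤ ∑ i, ‖linearization T hT hT₀ (m i)‖ * ‖g i‖ := by
        refine (Finset.abs_sum_le_sum_abs _ _).trans (Finset.sum_le_sum fun i _ => ?_)
        exact (linearization T hT hT₀ (m i)).1.le_opNorm (g i)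
    _ ≤ strongNorm p (fun i => linearization T hT hT₀ (m i)) * strongNorm p.conjExponent g :=
        sum_norm_mul_norm_le p _ _ g
    _ ≤ C * weakNorm p m * strongNorm p.conjExponent g :=
        mul_le_mul_of_nonneg_right (hb n m) (strongNorm_nonneg _ g)

theorem IsPairingBounded.isSumming (h : IsPairingBounded T hT hT₀ p) :
    IsSumming (E := ↥(lipFree x₀)) (F := ↥(lipFree y₀)) p (linearization T hT hT₀) := by
  obtain ⟨C, hC, hb⟩ := h
  refine ⟨2 * C, by positivity, fun n m => ?_⟩
  -- The norm of `T̃ m_i` in the dual of `Y^#` need not be known to be attained: half of it suffices.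
  choose g hg hgm using fun i => exists_norm_le_two_mul_apply (linearization T hT hT₀ (m i)).1
  obtain ⟨a, ha, ha1, hae⟩ := exists_sum_mul_norm_eq p p.conjExponent
    fun i => linearization T hT hT₀ (m i)
  have hag : strongNorm p.conjExponent (fun i => a i • g i) ≤ 1 := by
    refine (strongNorm_mono _ fun i => ?_).trans ha1
    rw [norm_smul]
    exact mul_le_of_le_one_right (norm_nonneg _) (hg i)
  calc strongNorm p (fun i => linearization T hT hT₀ (m i))
      = ∑ i, a i * ‖linearization T hT hT₀ (m i)‖ := hae.symm
    _ ≤ ∑ i, a i * (2 * (m i).1 (lipAdjoint T hT hT₀ (g i))) :=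
        Finset.sum_le_sum fun i _ => mul_le_mul_of_nonneg_left (hgm i) (ha i)
    _ = 2 * ∑ i, (m i).1 (lipAdjoint T hT hT₀ (a i • g i)) := by
        rw [Finset.mul_sum]
        refine Finset.sum_congr rfl fun i _ => ?_
        rw [map_smul, map_smul, smul_eq_mul]
        ring
    _ ≤ 2 * (C * weakNorm p m * strongNorm p.conjExponent fun i => a i • g i) :=
        mul_le_mul_of_nonneg_left ((le_abs_self _).trans (hb n m _)) zero_le_two
    _ ≤ 2 * (C * weakNorm p m * 1) := by
        have := weakNorm_nonneg p m
        gcongr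
    _ = 2 * C * weakNorm p m := by ring

/-! ### Cohen strongly summing adjoints -/

theorem IsCohenStronglySumming.isPairingBounded
    (h : IsCohenStronglySumming p.conjExponent (lipAdjoint T hT hT₀)) :
    IsPairingBounded T hT hT₀ p := by
  obtain ⟨C, hC, hb⟩ := h
  refine ⟨C, hC, fun n m g => ?_⟩
  have hp : p.conjExponent.conjExponent = p := ENNReal.HolderConjugate.conjExponent_eq
  rw [hp] at hb
  refine (Finset.abs_sum_le_sum_abs _ _).trans
    ((hb n g fun i => freeInclusion x₀ (m i)).trans ?_)
  rw [mul_right_comm]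
  gcongr
  · exact strongNorm_nonneg _ g
  · exact weakNorm_map_le p _ (norm_freeInclusion_le x₀) m

theorem IsPairingBounded.isCohenStronglySumming (h : IsPairingBounded T hT hT₀ p) :
    IsCohenStronglySumming p.conjExponent (lipAdjoint T hT hT₀) := by
  obtain ⟨C, hC, hb⟩ := h
  refine ⟨4 * C, by positivity, fun n g φ => ?_⟩
  have hp : p.conjExponent.conjExponent = p := ENNReal.HolderConjugate.conjExponent_eq
  rw [hp]
  -- Signs are moved onto the `g_i`, which does not change their strong norm.
  let ε : Fin n → ℝ := fun i => if 0 ≤ φ i (lipAdjoint T hT hT₀ (g i)) then 1 else -1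
  have hε : ∀ i, |φ i (lipAdjoint T hT hT₀ (g i))| =
      φ i (lipAdjoint T hT hT₀ (ε i • g i)) := by
    intro i
    rw [map_smul, map_smul, smul_eq_mul]
    by_cases h : 0 ≤ φ i (lipAdjoint T hT hT₀ (g i))
    · simp only [ε, if_pos h, one_mul, abs_of_nonneg h]
    · simp only [ε, if_neg h, neg_one_mul, abs_of_neg (not_le.1 h)]
  have hεg : strongNorm p.conjExponent (fun i => ε i • g i) = strongNorm p.conjExponent g := by
    refine strongNorm_congr _ fun i => ?_
    rw [norm_smul]
    by_cases h : 0 ≤ φ i (lipAdjoint T hT hT₀ (g i)) <;> simp [ε, h]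
  let ℓ : Fin n → NormedHom ↥(lipFree x₀) ℝ := fun i =>
    (NormedSpace.inclusionInDoubleDual ℝ _ (lipAdjoint T hT hT₀ (ε i • g i))).comp
      (freeInclusion x₀)
  -- The functional on `F(X)` given by an element of `X^#` comes back to that element.
  have hDℓ : ∀ i, freeDualToLip x₀ (ℓ i) = lipAdjoint T hT hT₀ (ε i • g i) := by
    intro i
    ext x
    change lipAdjoint T hT hT₀ (ε i • g i) x - lipAdjoint T hT hT₀ (ε i • g i) x₀ = _
    rw [LipZero.apply_base, sub_zero]
  have key := sum_apply_dual_le p (freeDualToLip x₀) (norm_freeDualToLip_le x₀) ℓ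
    (C := C * strongNorm p.conjExponent g)
    (mul_nonneg hC.le (strongNorm_nonneg _ g)) (fun m => by
      rw [mul_right_comm, ← hεg]
      exact hb n m _) φ
  simp_rw [hε, ← hDℓ]
  exact key.trans_eq (by ring)

end Pairing

end

end LipschitzSumming

theorem proposition2p4 (p : ENNReal) (hp : 1 ≤ p) {X Y : Type*} [MetricSpace X] [MetricSpace Y]
    (x₀ : X) (y₀ : Y) (T : X → Y) (K : NNReal) (hT : LipschitzWith K T) (hT₀ : T x₀ = y₀) :
    List.TFAE [
      LipschitzSumming.IsMStrictlyLipschitzSumming p x₀ y₀ T,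
      LipschitzSumming.IsSumming (E := ↥(LipschitzSumming.lipFree x₀))
        (F := ↥(LipschitzSumming.lipFree y₀)) p (LipschitzSumming.linearization T hT hT₀),
      LipschitzSumming.IsCohenStronglySumming p.conjExponent
        (LipschitzSumming.lipAdjoint T hT hT₀)] := by
  have : Fact (1 ≤ p) := ⟨hp⟩
  tfae_have 1 → 2 := fun h =>
    LipschitzSumming.IsPairingBounded.isSumming
      (LipschitzSumming.IsMStrictlyLipschitzSumming.isPairingBounded h)
  tfae_have 2 → 3 := fun h =>
    LipschitzSumming.IsPairingBounded.isCohenStronglySumming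
      (LipschitzSumming.IsSumming.isPairingBounded h)
  tfae_have 3 → 1 := fun h =>
    LipschitzSumming.IsPairingBounded.isMStrictlyLipschitzSumming
      (LipschitzSumming.IsCohenStronglySumming.isPairingBounded h)
  tfae_finish
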